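/- Let $S$ and $A$ be measurable spaces of states and actions, $\mu_0$ an initial state distribution on $S$ and $\gamma\in(0,1)$ a discount factor. A model is a jointly measurable function $P(s',r\mid s,a)\ge 0$ that is, for each $(s,a)$, a probability density of the next state $s'$ and the reward $r\in\mathbb R$ with respect to a fixed s-finite reference kernel $\nu(ds',dr\mid s,a)$ (for instance a counting measure, for discrete models). For a Markovian policy $\pi$ (a Markov kernel from $S$ to $A$) let $V^\pi_P=\mathbb E_{\pi,P}\big[\sum_{t\ge 0}\gamma^t r_t\big]$ be the expected discounted return when $s_0\sim\mu_0$, $a_t\sim\pi(\cdot\mid s_t)$ and $(s_{t+1},r_t)\sim P(\cdot\mid s_t,a_t)$. Let $\mathcal M$ be a class of models that contains the true model $T$, and let $\mathcal D=\{(s_i,a_i,r_i,s_i')\}_{i=1}^n$, $n\ge1$, consist of independent transitions with $(s_i,a_i)\sim\rho$ and $(s_i',r_i)\sim T(\cdot\mid s_i,a_i)$, for a probability distribution $\rho$ on $S\times A$. Let $\widehat T_{\mathrm{MLE}}\in\mathcal M$ be any maximizer over $\mathcal M$ of the likelihood $\prod_{i=1}^n P(s_i',r_i\mid s_i,a_i)$,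 and for $\xi>0$ let $$\mathcal M_{\mathcal D}=\Big\{\widehat T\in\mathcal M\ :\ \frac1n\sum_{i=1}^n \mathrm{TV}\big(\widehat T_{\mathrm{MLE}}(\cdot\mid s_i,a_i),\widehat T(\cdot\mid s_i,a_i)\big)^2\le\xi\Big\},\qquad \mathrm{TV}(P_1,P_2)=\sup_B|P_1(B)-P_2(B)| .$$ Let $\delta\in(0,1)$ and $\varepsilon\ge0$, and suppose that $\mathcal M$ is covered by $N$ brackets of width at most $\varepsilon$: there are measurable functions $0\le l_j\le u_j<\infty$, $j=1,\dots,N$, with $\int\!\!\int (u_j-l_j)\,d\nu(\cdot\mid s,a)\,d\rho(s,a)\le\varepsilon$ such that every $P\in\mathcal M$ satisfies $l_j\le P\le u_j$ everywhere for some $j$. (If $\mathcal M$ is finite, this holds with $N=|\mathcal M|$ and $\varepsilon=0$.) Suppose that $$\xi\ \ge\ 16\Big(\frac{\ln(2N/\delta)}{n}+\varepsilon\Big).$$ Then for any policy $\pi$ for which $\sum_{t\ge 0}\gamma^t|r_t|$ has finite expectation in every model of $\mathcal M$ (for instance, if rewards are bounded), with probability at least $1-\delta$ over $\mathcal D$,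 for every choice of $\widehat T_{\mathrm{MLE}}$, $$\inf_{\widehat T\in\mathcal M_{\mathcal D}}V^\pi_{\widehat T}\ \le\ V^\pi_T .$$ The infimum is over a nonempty set, and it is a minimum whenever it is attained, in particular if $\mathcal M$ is finite. -/

import Mathlib

open MeasureTheory ProbabilityTheory
open scoped NNReal ENNReal

namespace OfflineRL

/-- A model of the environment: for each state-action pair `x = (s, a)`, a probability density of
the joint outcome `y = (s', r)` (next state and reward) with respect to the reference measure
`ν x`. Counting measures give discrete models; the reference measure may depend on `(s, a)`, so
that for instance a known deterministic reward `r = R(s, a)` is covered as well. -/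
structure Model {S A : Type*} [MeasurableSpace S] [MeasurableSpace A]
    (ν : Kernel (S × A) (S × ℝ)) where
  density : S × A → S × ℝ → ℝ≥0
  measurable_density : Measurable (Function.uncurry density)
  lintegral_density : ∀ x, ∫⁻ y, density x y ∂(ν x) = 1

section

variable {S A : Type*} [MeasurableSpace S] [MeasurableSpace A]
  {ν : Kernel (S × A) (S × ℝ)} [IsSFiniteKernel ν]

/-- The transition kernel `P(s', r | s, a)` of a model. -/
noncomputable def Model.kernel (P : Model ν) : Kernel (S × A) (S × ℝ) :=
  ν.withDensity fun x y => (P.density x y : ℝ≥0∞)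

instance (P : Model ν) : IsMarkovKernel P.kernel where
  isProbabilityMeasure x := by
    have hm : Measurable (Function.uncurry fun x y => (P.density x y : ℝ≥0∞)) :=
      measurable_coe_nnreal_ennreal.comp P.measurable_density
    constructor
    rw [Model.kernel, Kernel.withDensity_apply' _ hm, setLIntegral_univ]
    exact P.lintegral_density x

/-- One transition `((s, a), (s', r))` from the state `s`: `a ∼ π(· | s)`, `(s', r) ∼ P(· | s, a)`. -/
noncomputable def stepKernel (π : Kernel S A) (P : Model ν) :
    Kernel S ((S × A) × (S × ℝ)) :=
  (Kernel.id ×ₖ π) ⊗ₖ (Kernel.prodMkLeft S P.kernel)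

instance (π : Kernel S A) [IsMarkovKernel π] (P : Model ν) :
    IsMarkovKernel (stepKernel π P) := by
  unfold stepKernel
  infer_instance

/-- The transition at time `n + 1` given the transitions up to time `n`: it starts in the state
reached by the transition at time `n`. -/
noncomputable def nextKernel (π : Kernel S A) (P : Model ν) (n : ℕ) :
    Kernel ((_ : Finset.Iic n) → (S × A) × (S × ℝ)) ((S × A) × (S × ℝ)) :=
  (stepKernel π P).comap (fun h => (h ⟨n, Finset.mem_Iic.2 le_rfl⟩).2.1) (by fun_prop)

instance (π : Kernel S A) [IsMarkovKernel π] (P : Model ν) (n : ℕ) :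
    IsMarkovKernel (nextKernel π P n) := by
  unfold nextKernel
  infer_instance

/-- The law of the infinite trajectory of transitions `((s_t, a_t), (s_{t+1}, r_t))` when `π` is
executed in the model `P` from `s_0 ∼ μ₀`. -/
noncomputable def trajectoryLaw (μ₀ : Measure S) (π : Kernel S A) [IsMarkovKernel π]
    (P : Model ν) : Measure (ℕ → (S × A) × (S × ℝ)) :=
  Kernel.trajMeasure (X := fun _ => (S × A) × (S × ℝ)) (stepKernel π P ∘ₘ μ₀) (nextKernel π P)

/-- The value is well defined: the discounted sum of rewards converges absolutely in expectation. -/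
def HasValue (μ₀ : Measure S) (γ : ℝ) (π : Kernel S A) [IsMarkovKernel π] (P : Model ν) : Prop :=
  ∫⁻ ω, ∑' t, ‖γ ^ t * (ω t).2.2‖ₑ ∂(trajectoryLaw μ₀ π P) < ∞

/-- The value `V^π_P`: the expected discounted return `∑ₜ γ ^ t * r_t` of `π` in the model `P`. -/
noncomputable def value (μ₀ : Measure S) (γ : ℝ) (π : Kernel S A) [IsMarkovKernel π]
    (P : Model ν) : ℝ :=
  ∫ ω, ∑' t, γ ^ t * (ω t).2.2 ∂(trajectoryLaw μ₀ π P)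

/-- The total variation distance `sup_B |μ B - μ' B|` of two probability measures. -/
noncomputable def tvDist {Ω : Type*} [MeasurableSpace Ω] (μ μ' : Measure Ω) : ℝ :=
  ⨆ B : {B : Set Ω // MeasurableSet B}, |μ.real B.1 - μ'.real B.1|

/-- The law of a dataset of `n` independent transitions `((s_i, a_i), (s_i', r_i))` with
`(s_i, a_i) ∼ ρ` and `(s_i', r_i) ∼ T(· | s_i, a_i)`. -/
noncomputable def datasetLaw (ρ : Measure (S × A)) (T : Model ν) (n : ℕ) :
    Measure (Fin n → (S × A) × (S × ℝ)) :=
  Measure.pi fun _ => ρ ⊗ₘ T.kernel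

/-- `P` is a maximum likelihood estimate in the class `M` for the dataset `D`. -/
def IsMLE (M : Set (Model ν)) {n : ℕ} (D : Fin n → (S × A) × (S × ℝ)) (P : Model ν) : Prop :=
  P ∈ M ∧ ∀ Q ∈ M, ∏ i, Q.density (D i).1 (D i).2 ≤ ∏ i, P.density (D i).1 (D i).2

/-- The models in `M` whose squared total variation distance to `Pmle`, averaged over the
state-action pairs of the dataset `D`, is at most `ξ`. -/
def plausibleModels (M : Set (Model ν)) (ξ : ℝ) {n : ℕ} (D : Fin n → (S × A) × (S × ℝ))
    (Pmle : Model ν) : Set (Model ν) :=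
  {P ∈ M | (∑ i, tvDist (Pmle.kernel (D i).1) (P.kernel (D i).1) ^ 2) / n ≤ ξ}

/-- `M` is covered by `N` brackets `[l j, u j]` of `L¹(ρ ⊗ ν)`-width at most `ε`. A class of `N`
models is covered by `N` brackets of width `0`. -/
def HasBracketing (ρ : Measure (S × A)) (M : Set (Model ν)) (ε : ℝ) (N : ℕ) : Prop :=
  ∃ l u : Fin N → S × A → S × ℝ → ℝ≥0,
    (∀ j, Measurable (Function.uncurry (l j)) ∧ Measurable (Function.uncurry (u j))) ∧
    (∀ j x y, l j x y ≤ u j x y) ∧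
    (∀ j, ∫⁻ x, ∫⁻ y, ((u j x y - l j x y : ℝ≥0) : ℝ≥0∞) ∂(ν x) ∂ρ ≤ ENNReal.ofReal ε) ∧
    ∀ P ∈ M, ∃ j, ∀ x y, l j x y ≤ P.density x y ∧ P.density x y ≤ u j x y

end

end OfflineRL

/-!
The upper end `u` of a bracket dominates its models and has mass at most `1 + ε` on average, so the
score `√(u / t) * (∫ u) / ∫ √(u t)` of a transition, where `t` is the true density, has mean at most
`1 + ε` under the truth. By independence the product of the scores over the dataset has mean at most
`exp (n ε)`; summing over the `N` brackets, Markov's inequality bounds the sum by `N exp (n ε) / δ`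
outside an event of probability at most `δ`. If a model below `u` is at least as likely as the
truth, then the product of the `√(u / t)` is at least `1`, while by the Cauchy–Schwarz inequality
each factor `(∫ u) / ∫ √(u t)` is at least `exp (TV ^ 2 / 4)`. Hence such a model, in particular any
maximum likelihood estimate, is close to the truth, so that the truth is plausible.
-/

namespace OfflineRL

section Affinity

variable {Y : Type*} [MeasurableSpace Y] {m : Measure Y}

lemma sq_integral_mul_le {f g : Y → ℝ} (hf : MemLp f 2 m) (hg : MemLp g 2 m) :
    (∫ y, f y * g y ∂m) ^ 2 ≤ (∫ y, f y ^ 2 ∂m) * ∫ y, g y ^ 2 ∂m := by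
  have hnorm : |∫ y, f y * g y ∂m| ≤ √(∫ y, f y ^ 2 ∂m) * √(∫ y, g y ^ 2 ∂m) :=
    calc |∫ y, f y * g y ∂m| ≤ ∫ y, ‖f y‖ * ‖g y‖ ∂m := by
          simp_rw [← norm_mul]
          exact norm_integral_le_integral_norm fun y => f y * g y
      _ ≤ √(∫ y, f y ^ 2 ∂m) * √(∫ y, g y ^ 2 ∂m) := by
          simpa [Real.sqrt_eq_rpow] using integral_mul_norm_le_Lp_mul_Lq
            Real.HolderConjugate.two_two (f := f) (g := g) (by simpa using hf) (by simpa using hg)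
  calc (∫ y, f y * g y ∂m) ^ 2 = |∫ y, f y * g y ∂m| ^ 2 := (sq_abs _).symm
    _ ≤ (√(∫ y, f y ^ 2 ∂m) * √(∫ y, g y ^ 2 ∂m)) ^ 2 := by gcongr
    _ = (∫ y, f y ^ 2 ∂m) * ∫ y, g y ^ 2 ∂m := by
        rw [mul_pow, Real.sq_sqrt (integral_nonneg fun y => sq_nonneg (f y)),
          Real.sq_sqrt (integral_nonneg fun y => sq_nonneg (g y))]

lemma memLp_two_sqrt {f : Y → ℝ} (hf0 : ∀ y, 0 ≤ f y) (hf : Integrable f m) :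
    MemLp (fun y => √(f y)) 2 m :=
  (memLp_two_iff_integrable_sq
    (Real.continuous_sqrt.comp_aestronglyMeasurable hf.aestronglyMeasurable)).2 <| by
      simpa only [Real.sq_sqrt (hf0 _)] using hf

lemma sq_integral_abs_sub_add_four_mul_sq_integral_sqrt_le {f g : Y → ℝ} (hf0 : ∀ y, 0 ≤ f y)
    (hg0 : ∀ y, 0 ≤ g y) (hf : Integrable f m) (hg : Integrable g m) :
    (∫ y, |f y - g y| ∂m) ^ 2 + 4 * (∫ y, √(f y) * √(g y) ∂m) ^ 2 ≤
      (∫ y, f y ∂m + ∫ y, g y ∂m) ^ 2 := by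
  have hsf := memLp_two_sqrt hf0 hf
  have hsg := memLp_two_sqrt hg0 hg
  have hfg : Integrable (fun y => f y + g y) m := hf.add hg
  have hs : Integrable (fun y => 2 * (√(f y) * √(g y))) m := (hsf.integrable_mul hsg).const_mul 2
  have habs : ∀ y, |√(f y) - √(g y)| * (√(f y) + √(g y)) = |f y - g y| := fun y => by
    rw [← abs_of_nonneg (add_nonneg (Real.sqrt_nonneg (f y)) (Real.sqrt_nonneg (g y))), ← abs_mul]
    congr 1
    linear_combination Real.sq_sqrt (hf0 y) - Real.sq_sqrt (hg0 y)
  have hsub : ∫ y, |√(f y) - √(g y)| ^ 2 ∂m =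
      ∫ y, f y ∂m + ∫ y, g y ∂m - 2 * ∫ y, √(f y) * √(g y) ∂m := by
    rw [← integral_add hf hg, ← integral_const_mul, ← integral_sub hfg hs]
    refine integral_congr_ae (ae_of_all _ fun y => ?_)
    simp only [sq_abs]
    linear_combination Real.sq_sqrt (hf0 y) + Real.sq_sqrt (hg0 y)
  have hadd : ∫ y, (√(f y) + √(g y)) ^ 2 ∂m =
      ∫ y, f y ∂m + ∫ y, g y ∂m + 2 * ∫ y, √(f y) * √(g y) ∂m := by
    rw [← integral_add hf hg, ← integral_const_mul, ← integral_add hfg hs]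
    refine integral_congr_ae (ae_of_all _ fun y => ?_)
    linear_combination Real.sq_sqrt (hf0 y) + Real.sq_sqrt (hg0 y)
  have hcs := sq_integral_mul_le (hsf.sub hsg).abs (hsf.add hsg)
  simp only [Pi.sub_apply, Pi.add_apply, Pi.abs_apply, habs, hsub, hadd] at hcs
  linarith

lemma integrable_coe_of_lintegral_ne_top {p : Y → ℝ≥0} (hp : Measurable p)
    (h : ∫⁻ y, p y ∂m ≠ ∞) : Integrable (fun y => (p y : ℝ)) m :=
  integrable_toReal_of_lintegral_ne_top hp.coe_nnreal_ennreal.aemeasurable h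

lemma integral_coe_eq_toReal_lintegral {p : Y → ℝ≥0} (hp : Measurable p) :
    ∫ y, (p y : ℝ) ∂m = (∫⁻ y, p y ∂m).toReal :=
  integral_toReal hp.coe_nnreal_ennreal.aemeasurable (ae_of_all _ fun _ => ENNReal.coe_lt_top)

lemma real_withDensity_apply {p : Y → ℝ≥0} (hp : Measurable p) {B : Set Y}
    (hB : MeasurableSet B) :
    (m.withDensity fun y => (p y : ℝ≥0∞)).real B = ∫ y in B, (p y : ℝ) ∂m := by
  rw [Measure.real, withDensity_apply _ hB, integral_coe_eq_toReal_lintegral hp]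

lemma tvDist_nonneg (μ μ' : Measure Y) : 0 ≤ tvDist μ μ' :=
  Real.iSup_nonneg fun _ => abs_nonneg _

lemma tvDist_le {μ μ' : Measure Y} {c : ℝ}
    (h : ∀ B, MeasurableSet B → |μ.real B - μ'.real B| ≤ c) : tvDist μ μ' ≤ c :=
  have : Nonempty {B : Set Y // MeasurableSet B} := ⟨⟨∅, .empty⟩⟩
  ciSup_le fun B => h B.1 B.2

lemma tvDist_le_one (μ μ' : Measure Y) [IsZeroOrProbabilityMeasure μ]
    [IsZeroOrProbabilityMeasure μ'] : tvDist μ μ' ≤ 1 :=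
  tvDist_le fun _ _ => abs_sub_le_of_nonneg_of_le measureReal_nonneg measureReal_le_one
    measureReal_nonneg measureReal_le_one

lemma two_mul_abs_setIntegral_le {f : Y → ℝ} (hf : Integrable f m) (hf0 : ∫ y, f y ∂m = 0)
    {B : Set Y} (hB : MeasurableSet B) : 2 * |∫ y in B, f y ∂m| ≤ ∫ y, |f y| ∂m := by
  have hcompl : ∫ y in Bᶜ, f y ∂m = -∫ y in B, f y ∂m := by
    linarith [integral_add_compl hB hf]
  calc 2 * |∫ y in B, f y ∂m| = |∫ y in B, f y ∂m| + |∫ y in Bᶜ, f y ∂m| := by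
        rw [hcompl, abs_neg, two_mul]
    _ ≤ ∫ y in B, |f y| ∂m + ∫ y in Bᶜ, |f y| ∂m :=
        add_le_add abs_integral_le_integral_abs abs_integral_le_integral_abs
    _ = ∫ y, |f y| ∂m := integral_add_compl hB hf.abs

lemma two_mul_tvDist_withDensity_le {p t : Y → ℝ≥0} (hp : Measurable p) (ht : Measurable t)
    (hpt : ∫⁻ y, p y ∂m = ∫⁻ y, t y ∂m) (hfin : ∫⁻ y, t y ∂m ≠ ∞) :
    2 * tvDist (m.withDensity fun y => (p y : ℝ≥0∞)) (m.withDensity fun y => (t y : ℝ≥0∞)) ≤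
      ∫ y, |(p y : ℝ) - t y| ∂m := by
  have hpi := integrable_coe_of_lintegral_ne_top hp (hpt ▸ hfin)
  have hti := integrable_coe_of_lintegral_ne_top ht hfin
  have hzero : ∫ y, ((p y : ℝ) - t y) ∂m = 0 := by
    rw [integral_sub hpi hti, integral_coe_eq_toReal_lintegral hp,
      integral_coe_eq_toReal_lintegral ht, hpt, sub_self]
  rw [← le_div_iff₀' two_pos]
  refine tvDist_le fun B hB => ?_
  rw [real_withDensity_apply hp hB, real_withDensity_apply ht hB,
    ← integral_sub hpi.integrableOn hti.integrableOn, le_div_iff₀' two_pos]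
  exact two_mul_abs_setIntegral_le (hpi.sub hti) hzero hB

lemma integral_abs_sub_le_of_le {p t u : Y → ℝ} (hp : Integrable p m) (ht : Integrable t m)
    (hu : Integrable u m) (hpu : ∀ y, p y ≤ u y) :
    ∫ y, |p y - t y| ∂m ≤ ∫ y, |u y - t y| ∂m + (∫ y, u y ∂m - ∫ y, p y ∂m) := by
  have hut : Integrable (fun y => |u y - t y|) m := (hu.sub ht).abs
  have hup : Integrable (fun y => u y - p y) m := hu.sub hp
  rw [← integral_sub hu hp, ← integral_add hut hup]
  refine integral_mono (hp.sub ht).abs (hut.add hup) fun y => ?_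
  calc |p y - t y| ≤ |p y - u y| + |u y - t y| := abs_sub_le _ _ _
    _ = |u y - t y| + (u y - p y) := by
        rw [abs_of_nonpos (sub_nonpos.2 (hpu y)), neg_sub, add_comm]

lemma exp_sq_div_four_mul_le {τ a U Z : ℝ} (hτ0 : 0 ≤ τ) (hτ1 : τ ≤ 1) (hU : 1 ≤ U)
    (haZ : a ^ 2 + 4 * Z ^ 2 ≤ (U + 1) ^ 2) (hτ : 2 * τ ≤ a + (U - 1)) :
    Real.exp (τ ^ 2 / 4) * Z ≤ U := by
  have hZ : Z ^ 2 ≤ Real.exp (-(τ ^ 2 / 2)) * U ^ 2 :=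
    calc Z ^ 2 ≤ (1 - τ ^ 2 / 2) * U ^ 2 := by
          have hτ_sq : τ ^ 2 ≤ 1 := pow_le_one₀ hτ0 hτ1
          have hτ_sq_le : 2 * τ ^ 2 ≤ a ^ 2 + (U - 1) ^ 2 := by
            nlinarith [sq_nonneg (a - (U - 1))]
          nlinarith [mul_le_mul_of_nonneg_right hτ_sq (by nlinarith : 0 ≤ U ^ 2 - 1)]
      _ ≤ Real.exp (-(τ ^ 2 / 2)) * U ^ 2 := by
          gcongr
          exact Real.one_sub_le_exp_neg _
  refine le_of_sq_le_sq ?_ (by positivity)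
  calc (Real.exp (τ ^ 2 / 4) * Z) ^ 2 = Real.exp (τ ^ 2 / 2) * Z ^ 2 := by
        rw [mul_pow, ← Real.exp_nat_mul]
        ring_nf
    _ ≤ Real.exp (τ ^ 2 / 2) * (Real.exp (-(τ ^ 2 / 2)) * U ^ 2) := by gcongr
    _ = U ^ 2 := by rw [← mul_assoc, ← Real.exp_add, add_neg_cancel, Real.exp_zero, one_mul]

/-- The Hellinger affinity `∫ √(f g) dm` of two densities, through which the Cauchy–Schwarz
inequality bounds the total variation distance. -/
noncomputable def hellingerAffinity (m : Measure Y) (f g : Y → ℝ≥0) : ℝ≥0∞ :=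
  ∫⁻ y, NNReal.sqrt (f y * g y) ∂m

lemma hellingerAffinity_eq_ofReal_integral {f g : Y → ℝ≥0} (hf : Measurable f)
    (hg : Measurable g) (hf_fin : ∫⁻ y, f y ∂m ≠ ∞) (hg_fin : ∫⁻ y, g y ∂m ≠ ∞) :
    hellingerAffinity m f g = ENNReal.ofReal (∫ y, √(f y : ℝ) * √(g y : ℝ) ∂m) := by
  have hint : Integrable (fun y => √(f y : ℝ) * √(g y : ℝ)) m :=
    (memLp_two_sqrt (fun y => (f y).coe_nonneg)
      (integrable_coe_of_lintegral_ne_top hf hf_fin)).integrable_mul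
      (memLp_two_sqrt (fun y => (g y).coe_nonneg) (integrable_coe_of_lintegral_ne_top hg hg_fin))
  rw [ofReal_integral_eq_lintegral_ofReal hint (ae_of_all _ fun y => by positivity),
    hellingerAffinity]
  refine lintegral_congr fun y => ?_
  rw [← Real.sqrt_mul (f y).coe_nonneg, ← NNReal.coe_mul, ← Real.coe_sqrt,
    ENNReal.ofReal_coe_nnreal]

lemma exp_sq_tvDist_mul_hellingerAffinity_le {p t u : Y → ℝ≥0} (hp : Measurable p)
    (ht : Measurable t) (hu : Measurable u) (hp1 : ∫⁻ y, p y ∂m = 1) (ht1 : ∫⁻ y, t y ∂m = 1)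
    (hpu : ∀ y, p y ≤ u y) :
    ENNReal.ofReal (Real.exp (tvDist (m.withDensity fun y => (p y : ℝ≥0∞))
        (m.withDensity fun y => (t y : ℝ≥0∞)) ^ 2 / 4)) * hellingerAffinity m u t ≤
      ∫⁻ y, u y ∂m := by
  rcases eq_or_ne (∫⁻ y, u y ∂m) ∞ with hu_top | hu_fin
  · exact hu_top ▸ le_top
  have hp_fin : ∫⁻ y, p y ∂m ≠ ∞ := hp1 ▸ ENNReal.one_ne_top
  have ht_fin : ∫⁻ y, t y ∂m ≠ ∞ := ht1 ▸ ENNReal.one_ne_top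
  have hpi := integrable_coe_of_lintegral_ne_top hp hp_fin
  have hti := integrable_coe_of_lintegral_ne_top ht ht_fin
  have hui := integrable_coe_of_lintegral_ne_top hu hu_fin
  have hP : ∫ y, (p y : ℝ) ∂m = 1 := by simp [integral_coe_eq_toReal_lintegral hp, hp1]
  have hT : ∫ y, (t y : ℝ) ∂m = 1 := by simp [integral_coe_eq_toReal_lintegral ht, ht1]
  have hU : 1 ≤ ∫ y, (u y : ℝ) ∂m := hP ▸ integral_mono hpi hui hpu
  have : IsProbabilityMeasure (m.withDensity fun y => (p y : ℝ≥0∞)) := ⟨by simp [hp1]⟩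
  have : IsProbabilityMeasure (m.withDensity fun y => (t y : ℝ≥0∞)) := ⟨by simp [ht1]⟩
  have hcs := sq_integral_abs_sub_add_four_mul_sq_integral_sqrt_le
    (fun y => (u y).coe_nonneg) (fun y => (t y).coe_nonneg) hui hti
  have htri := integral_abs_sub_le_of_le hpi hti hui hpu
  rw [hT] at hcs
  rw [hP] at htri
  rw [hellingerAffinity_eq_ofReal_integral hu ht hu_fin ht_fin,
    ← ENNReal.ofReal_mul (Real.exp_pos _).le, ← ENNReal.ofReal_toReal hu_fin,
    ← integral_coe_eq_toReal_lintegral hu]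
  exact ENNReal.ofReal_le_ofReal <| exp_sq_div_four_mul_le (tvDist_nonneg _ _) (tvDist_le_one _ _)
    hU hcs ((two_mul_tvDist_withDensity_le hp ht (hp1.trans ht1.symm) ht_fin).trans htri)

end Affinity

section Score

variable {X Y : Type*} [MeasurableSpace X] [MeasurableSpace Y] {ν : Kernel X Y}
  {t u : X → Y → ℝ≥0}

/-- The root likelihood ratio `√(u / t)` of an envelope `u` and a conditional density `t`,
normalized by its conditional mean under `t`, which is `hellingerAffinity (ν x) (u x) (t x)`, and
rescaled by the mass of the envelope. -/
noncomputable def envelopeScore (ν : Kernel X Y) (t u : X → Y → ℝ≥0) (z : X × Y) : ℝ≥0∞ :=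
  NNReal.sqrt (u z.1 z.2 / t z.1 z.2) *
    ((∫⁻ y, u z.1 y ∂(ν z.1)) / hellingerAffinity (ν z.1) (u z.1) (t z.1))

lemma density_mul_envelopeScore_le (z : X × Y) :
    t z.1 z.2 * envelopeScore ν t u z ≤ NNReal.sqrt (u z.1 z.2 * t z.1 z.2) *
      ((∫⁻ y, u z.1 y ∂(ν z.1)) / hellingerAffinity (ν z.1) (u z.1) (t z.1)) := by
  have hroot : t z.1 z.2 * NNReal.sqrt (u z.1 z.2 / t z.1 z.2) ≤
      NNReal.sqrt (u z.1 z.2 * t z.1 z.2) := by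
    rcases eq_or_ne (t z.1 z.2) 0 with h0 | h0
    · simp [h0]
    · rw [NNReal.le_sqrt_iff_sq_le, mul_pow, NNReal.sq_sqrt]
      exact le_of_eq (by field_simp)
  rw [envelopeScore, ← mul_assoc]
  gcongr
  exact_mod_cast hroot

lemma lintegral_density_mul_envelopeScore_le (ht : Measurable (Function.uncurry t))
    (hu : Measurable (Function.uncurry u)) (x : X) :
    ∫⁻ y, t x y * envelopeScore ν t u (x, y) ∂(ν x) ≤ ∫⁻ y, u x y ∂(ν x) := by
  have hroot : Measurable fun y => NNReal.sqrt (u x y * t x y) :=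
    NNReal.continuous_sqrt.measurable.comp (hu.of_uncurry_left.mul ht.of_uncurry_left)
  calc ∫⁻ y, t x y * envelopeScore ν t u (x, y) ∂(ν x)
      ≤ ∫⁻ y, NNReal.sqrt (u x y * t x y) *
          ((∫⁻ y, u x y ∂(ν x)) / hellingerAffinity (ν x) (u x) (t x)) ∂(ν x) :=
        lintegral_mono fun y => density_mul_envelopeScore_le (x, y)
    _ = hellingerAffinity (ν x) (u x) (t x) *
          ((∫⁻ y, u x y ∂(ν x)) / hellingerAffinity (ν x) (u x) (t x)) :=
        lintegral_mul_const _ hroot.coe_nnreal_ennreal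
    _ ≤ ∫⁻ y, u x y ∂(ν x) := ENNReal.mul_div_le

variable [IsSFiniteKernel ν]

lemma measurable_lintegral_kernel (hu : Measurable (Function.uncurry u)) :
    Measurable fun x => ∫⁻ y, u x y ∂(ν x) :=
  hu.coe_nnreal_ennreal.lintegral_kernel_prod_right

lemma measurable_hellingerAffinity_kernel (ht : Measurable (Function.uncurry t))
    (hu : Measurable (Function.uncurry u)) :
    Measurable fun x => hellingerAffinity (ν x) (u x) (t x) :=
  (NNReal.continuous_sqrt.measurable.comp
    (hu.mul ht)).coe_nnreal_ennreal.lintegral_kernel_prod_right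

lemma measurable_envelopeScore (ht : Measurable (Function.uncurry t))
    (hu : Measurable (Function.uncurry u)) : Measurable (envelopeScore ν t u) :=
  (NNReal.continuous_sqrt.measurable.comp (hu.div ht)).coe_nnreal_ennreal.mul <|
    ((measurable_lintegral_kernel hu).div
      (measurable_hellingerAffinity_kernel ht hu)).comp measurable_fst

lemma lintegral_envelopeScore_le (ρ : Measure X) [SFinite ρ]
    (ht : Measurable (Function.uncurry t)) (hu : Measurable (Function.uncurry u)) :
    ∫⁻ z, envelopeScore ν t u z ∂(ρ ⊗ₘ ν.withDensity fun x y => (t x y : ℝ≥0∞)) ≤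
      ∫⁻ x, ∫⁻ y, u x y ∂(ν x) ∂ρ := by
  have ht' : Measurable fun z : X × Y => (t z.1 z.2 : ℝ≥0∞) := ht.coe_nnreal_ennreal
  have hscore := measurable_envelopeScore (ν := ν) ht hu
  rw [Measure.compProd_withDensity ht', lintegral_withDensity_eq_lintegral_mul _ ht' hscore,
    Measure.lintegral_compProd (ht'.mul hscore)]
  exact lintegral_mono fun x => lintegral_density_mul_envelopeScore_le ht hu x

lemma ae_compProd_withDensity_pos (ρ : Measure X) [SFinite ρ]
    (ht : Measurable (Function.uncurry t)) :
    ∀ᵐ z ∂(ρ ⊗ₘ ν.withDensity fun x y => (t x y : ℝ≥0∞)), 0 < t z.1 z.2 := by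
  have ht' : Measurable fun z : X × Y => (t z.1 z.2 : ℝ≥0∞) := ht.coe_nnreal_ennreal
  rw [Measure.compProd_withDensity ht', ae_withDensity_iff ht']
  exact ae_of_all _ fun z hz => pos_iff_ne_zero.2 (by simpa using hz)

end Score

section Concentration

variable {ι : Type*} [Fintype ι]

lemma lintegral_pi_prod {Ω : ι → Type*} [∀ i, MeasurableSpace (Ω i)] {μ : ∀ i, Measure (Ω i)}
    [∀ i, IsProbabilityMeasure (μ i)] {f : ∀ i, Ω i → ℝ≥0∞} (hf : ∀ i, Measurable (f i)) :
    ∫⁻ ω, ∏ i, f i (ω i) ∂(Measure.pi μ) = ∏ i, ∫⁻ z, f i z ∂(μ i) :=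
  (lintegral_prod_eq_prod_lintegral_of_indepFun Finset.univ (fun i (ω : ∀ i, Ω i) => f i (ω i))
    (iIndepFun_pi fun i => (hf i).aemeasurable)
    fun i => (hf i).comp (measurable_pi_apply i)).trans <|
  Finset.prod_congr rfl fun i _ => (measurePreserving_eval μ i).lintegral_comp (hf i)

lemma measure_pi_sum_prod_ge_le {J Z : Type*} [Fintype J] [MeasurableSpace Z] {μ : Measure Z}
    [IsProbabilityMeasure μ] {f : J → Z → ℝ≥0∞} (hf : ∀ j, Measurable (f j)) {c : ℝ≥0∞}
    (hc : c ≠ 0) (hc_top : c ≠ ∞) :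
    Measure.pi (fun _ : ι => μ) {D | c ≤ ∑ j, ∏ i, f j (D i)} ≤
      (∑ j, (∫⁻ z, f j z ∂μ) ^ Fintype.card ι) / c := by
  have hprod : ∀ j, Measurable fun D : ι → Z => ∏ i, f j (D i) := fun j =>
    Finset.measurable_fun_prod _ fun i _ => (hf j).comp (measurable_pi_apply i)
  refine (meas_ge_le_lintegral_div (Finset.measurable_fun_sum _ fun j _ => hprod j).aemeasurable
    hc hc_top).trans_eq ?_
  rw [lintegral_finsetSum _ fun j _ => hprod j]
  simp only [lintegral_pi_prod fun _ => hf _, Finset.prod_const, Finset.card_univ]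

lemma exists_measurableSet_forall_of_ae_notMem {Ω : Type*} [MeasurableSpace Ω] {μ : Measure Ω}
    [IsProbabilityMeasure μ] {B : Set Ω} {q : Ω → Prop} {δ : ℝ} (hδ : 0 ≤ δ)
    (hB : μ B ≤ ENNReal.ofReal δ) (hq : ∀ᵐ ω ∂μ, ω ∉ B → q ω) :
    ∃ E, MeasurableSet E ∧ ENNReal.ofReal (1 - δ) ≤ μ E ∧ ∀ ω ∈ E, q ω := by
  have hbad : μ {ω | ¬q ω} ≤ ENNReal.ofReal δ :=
    (measure_mono_ae (hq.mono fun _ hω => not_imp_comm.1 hω)).trans hB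
  have hmeas := measurableSet_toMeasurable μ {ω | ¬q ω}
  refine ⟨(toMeasurable μ {ω | ¬q ω})ᶜ, hmeas.compl, ?_, fun ω hω => ?_⟩
  · rw [prob_compl_eq_one_sub hmeas, measure_toMeasurable, ENNReal.ofReal_sub _ hδ,
      ENNReal.ofReal_one]
    gcongr
  · exact not_not.1 fun hqω => hω (subset_toMeasurable μ _ hqω)

end Concentration

section Bracketing

variable {S A : Type*} [MeasurableSpace S] [MeasurableSpace A]
  {ν : Kernel (S × A) (S × ℝ)} {ρ : Measure (S × A)} {M : Set (Model ν)} {ε : ℝ} {N : ℕ}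

lemma HasBracketing.pos (hN : HasBracketing ρ M ε N)
    (hM : M.Nonempty) : 0 < N := by
  obtain ⟨_, _, -, -, -, hcover⟩ := hN
  obtain ⟨P, hP⟩ := hM
  obtain ⟨j, -⟩ := hcover P hP
  exact j.pos

lemma lintegral_le_one_add_of_density_mem_bracket [IsProbabilityMeasure ρ] (P : Model ν)
    {l u : S × A → S × ℝ → ℝ≥0} (hlP : ∀ x y, l x y ≤ P.density x y) :
    ∫⁻ x, ∫⁻ y, u x y ∂(ν x) ∂ρ ≤
      1 + ∫⁻ x, ∫⁻ y, ((u x y - l x y : ℝ≥0) : ℝ≥0∞) ∂(ν x) ∂ρ := by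
  calc ∫⁻ x, ∫⁻ y, u x y ∂(ν x) ∂ρ
      ≤ ∫⁻ x, ∫⁻ y, (P.density x y + (u x y - l x y : ℝ≥0) : ℝ≥0∞) ∂(ν x) ∂ρ := by
        gcongr with x y
        exact_mod_cast le_add_tsub.trans (add_le_add_left (hlP x y) _)
    _ = 1 + ∫⁻ x, ∫⁻ y, ((u x y - l x y : ℝ≥0) : ℝ≥0∞) ∂(ν x) ∂ρ := by
        simp only [lintegral_add_left P.measurable_density.of_uncurry_left.coe_nnreal_ennreal,
          P.lintegral_density, lintegral_add_left measurable_const, lintegral_one, measure_univ]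

lemma HasBracketing.exists_envelopes [IsProbabilityMeasure ρ] (hN : HasBracketing ρ M ε N) :
    ∃ u : Fin N → S × A → S × ℝ → ℝ≥0, (∀ j, Measurable (Function.uncurry (u j))) ∧
      (∀ j, ∫⁻ x, ∫⁻ y, u j x y ∂(ν x) ∂ρ ≤ 1 + ENNReal.ofReal ε) ∧
      ∀ P ∈ M, ∃ j, ∀ x y, P.density x y ≤ u j x y := by
  classical
  obtain ⟨l, u, hmeas, -, hwidth, hcover⟩ := hN
  -- A bracket whose lower end is below no model may have a mass far above `1`: replace it by `0`.
  let IsUsed (j : Fin N) : Prop := ∃ P : Model ν, ∀ x y, l j x y ≤ P.density x y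
  refine ⟨fun j => if IsUsed j then u j else 0, fun j => ?_, fun j => ?_, fun P hP => ?_⟩
  · by_cases hj : IsUsed j
    · simpa only [if_pos hj] using (hmeas j).2
    · simp only [if_neg hj]
      exact measurable_const
  · by_cases hj : IsUsed j
    · simp only [if_pos hj]
      obtain ⟨P, hlP⟩ := hj
      exact (lintegral_le_one_add_of_density_mem_bracket P hlP).trans (by gcongr; exact hwidth j)
    · simp [if_neg hj]
  · obtain ⟨j, hj⟩ := hcover P hP
    have hused : IsUsed j := ⟨P, fun x y => (hj x y).1⟩
    exact ⟨j, fun x y => by simpa only [if_pos hused] using (hj x y).2⟩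

end Bracketing

section Likelihood

variable {S A : Type*} [MeasurableSpace S] [MeasurableSpace A]
  {ν : Kernel (S × A) (S × ℝ)} [IsSFiniteKernel ν]
  {ρ : Measure (S × A)} {n : ℕ}

lemma Model.kernel_apply (P : Model ν) (x : S × A) :
    P.kernel x = (ν x).withDensity fun y => (P.density x y : ℝ≥0∞) :=
  Kernel.withDensity_apply (f := fun x y => (P.density x y : ℝ≥0∞)) ν
    P.measurable_density.coe_nnreal_ennreal x

instance [IsProbabilityMeasure ρ] (T : Model ν) :
    IsProbabilityMeasure (datasetLaw ρ T n) := by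
  unfold datasetLaw
  infer_instance

lemma ae_datasetLaw_forall [IsProbabilityMeasure ρ] {T : Model ν}
    {q : (S × A) × (S × ℝ) → Prop} (hq : ∀ᵐ z ∂(ρ ⊗ₘ T.kernel), q z) :
    ∀ᵐ D ∂(datasetLaw ρ T n), ∀ i, q (D i) :=
  ae_all_iff.2 fun _ => Measure.tendsto_eval_ae_ae.eventually hq

lemma one_le_prod_sqrt_div {ι : Type*} [Fintype ι] {t u : ι → ℝ≥0} (ht : ∀ i, 0 < t i)
    (htu : ∏ i, t i ≤ ∏ i, u i) : 1 ≤ ∏ i, NNReal.sqrt (u i / t i) :=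
  calc 1 ≤ NNReal.sqrt (∏ i, u i / t i) := by
        rwa [NNReal.one_le_sqrt, Finset.prod_div_distrib,
          one_le_div (Finset.prod_pos fun i _ => ht i)]
    _ = ∏ i, NNReal.sqrt (u i / t i) := map_prod NNReal.sqrtHom _ _

lemma exp_sq_tvDist_le_lintegral_div_hellingerAffinity (P T : Model ν)
    {u : S × A → S × ℝ → ℝ≥0} (hu : Measurable (Function.uncurry u))
    (hPu : ∀ x y, P.density x y ≤ u x y) {x : S × A} (hx : ∫⁻ y, u x y ∂(ν x) < ∞) :
    ENNReal.ofReal (Real.exp (tvDist (P.kernel x) (T.kernel x) ^ 2 / 4)) ≤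
      (∫⁻ y, u x y ∂(ν x)) / hellingerAffinity (ν x) (u x) (T.density x) := by
  have hmass : ∫⁻ y, u x y ∂(ν x) ≠ 0 := fun h => by
    have := (P.lintegral_density x).symm.trans_le
      (lintegral_mono fun y => ENNReal.coe_le_coe.2 (hPu x y))
    simp [h] at this
  rw [ENNReal.le_div_iff_mul_le (.inr hmass) (.inr hx.ne), P.kernel_apply, T.kernel_apply]
  exact exp_sq_tvDist_mul_hellingerAffinity_le P.measurable_density.of_uncurry_left
    T.measurable_density.of_uncurry_left hu.of_uncurry_left (P.lintegral_density x)
    (T.lintegral_density x) (hPu x)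

lemma exp_sum_sq_tvDist_le_prod_envelopeScore {P T : Model ν} {u : S × A → S × ℝ → ℝ≥0}
    (hu : Measurable (Function.uncurry u)) (hPu : ∀ x y, P.density x y ≤ u x y)
    {D : Fin n → (S × A) × (S × ℝ)} (hpos : ∀ i, 0 < T.density (D i).1 (D i).2)
    (hfin : ∀ i, ∫⁻ y, u (D i).1 y ∂(ν (D i).1) < ∞)
    (hlik : ∏ i, T.density (D i).1 (D i).2 ≤ ∏ i, P.density (D i).1 (D i).2) :
    ENNReal.ofReal (Real.exp ((∑ i, tvDist (P.kernel (D i).1) (T.kernel (D i).1) ^ 2) / 4)) ≤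
      ∏ i, envelopeScore ν T.density u (D i) := by
  have hroot : 1 ≤ ∏ i, (NNReal.sqrt (u (D i).1 (D i).2 / T.density (D i).1 (D i).2) : ℝ≥0∞) :=
    mod_cast one_le_prod_sqrt_div hpos (hlik.trans (Finset.prod_le_prod' fun i _ => hPu _ _))
  rw [Finset.sum_div, Real.exp_sum, ENNReal.ofReal_prod_of_nonneg fun i _ => (Real.exp_pos _).le]
  simp only [envelopeScore, Finset.prod_mul_distrib]
  exact (Finset.prod_le_prod' fun i _ =>
    exp_sq_tvDist_le_lintegral_div_hellingerAffinity P T hu hPu (hfin i)).trans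
      (le_mul_of_one_le_left' hroot)

lemma datasetLaw_sum_prod_envelopeScore_ge_le [IsProbabilityMeasure ρ] (T : Model ν)
    {ε δ : ℝ} (hε : 0 ≤ ε) (hδ : 0 < δ) {N : ℕ} (hN : 0 < N)
    {u : Fin N → S × A → S × ℝ → ℝ≥0} (hu : ∀ j, Measurable (Function.uncurry (u j)))
    (hmass : ∀ j, ∫⁻ x, ∫⁻ y, u j x y ∂(ν x) ∂ρ ≤ 1 + ENNReal.ofReal ε) :
    datasetLaw ρ T n {D | ENNReal.ofReal (N / δ * Real.exp (n * ε)) ≤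
      ∑ j, ∏ i, envelopeScore ν T.density (u j) (D i)} ≤ ENNReal.ofReal δ := by
  have hN' : (0 : ℝ) < N := mod_cast hN
  have hmean : ∀ j, ∫⁻ z, envelopeScore ν T.density (u j) z ∂(ρ ⊗ₘ T.kernel) ≤
      ENNReal.ofReal (Real.exp ε) := fun j =>
    calc _ ≤ 1 + ENNReal.ofReal ε :=
          (lintegral_envelopeScore_le ρ T.measurable_density (hu j)).trans (hmass j)
      _ = ENNReal.ofReal (ε + 1) := by
          rw [ENNReal.ofReal_add hε zero_le_one, ENNReal.ofReal_one, add_comm]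
      _ ≤ ENNReal.ofReal (Real.exp ε) := ENNReal.ofReal_le_ofReal (Real.add_one_le_exp ε)
  have hc : 0 < N / δ * Real.exp (n * ε) := by positivity
  calc _ ≤ (∑ j, (∫⁻ z, envelopeScore ν T.density (u j) z ∂(ρ ⊗ₘ T.kernel)) ^
          Fintype.card (Fin n)) / ENNReal.ofReal (N / δ * Real.exp (n * ε)) :=
        measure_pi_sum_prod_ge_le (fun j => measurable_envelopeScore T.measurable_density (hu j))
          (by simpa using hc) ENNReal.ofReal_ne_top
    _ ≤ (∑ _j : Fin N, ENNReal.ofReal (Real.exp ε) ^ n) /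
          ENNReal.ofReal (N / δ * Real.exp (n * ε)) := by
        rw [Fintype.card_fin]
        gcongr with j
        exact hmean j
    _ = ENNReal.ofReal (N * Real.exp (n * ε) / (N / δ * Real.exp (n * ε))) := by
        rw [Finset.sum_const, Finset.card_univ, Fintype.card_fin, nsmul_eq_mul,
          ← ENNReal.ofReal_pow (Real.exp_pos ε).le, ← Real.exp_nat_mul,
          ENNReal.ofReal_div_of_pos hc, ENNReal.ofReal_mul hN'.le, ENNReal.ofReal_natCast]
    _ = ENNReal.ofReal δ := by
        congr 1
        field_simp

end Likelihood

lemma mul_exp_le_exp_of_le_div {c n ε s : ℝ} (hc : 0 < c) (hn : 0 < n)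
    (h : 4 * (Real.log c / n + ε) ≤ s / n) : c * Real.exp (n * ε) ≤ Real.exp (s / 4) := by
  rw [← Real.exp_log hc, ← Real.exp_add, Real.exp_le_exp]
  rw [le_div_iff₀ hn] at h
  have : 4 * (Real.log c / n + ε) * n = 4 * (Real.log c + n * ε) := by field_simp
  linarith

lemma four_mul_log_div_add_le {δ ε : ℝ} (hδ : δ ∈ Set.Ioo (0 : ℝ) 1) (hε : 0 ≤ ε) {N : ℕ}
    (hN : 0 < N) (n : ℕ) :
    4 * (Real.log (N / δ) / n + ε) ≤ 16 * (Real.log (2 * N / δ) / n + ε) := by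
  have hδ0 := hδ.1
  have hN1 : (1 : ℝ) ≤ N := mod_cast hN
  have hlog0 : 0 ≤ Real.log (N / δ) :=
    Real.log_nonneg ((one_le_div hδ0).2 (hδ.2.le.trans hN1))
  have hlog : Real.log (N / δ) ≤ Real.log (2 * N / δ) := by
    gcongr
    linarith
  have hdiv : Real.log (N / δ) / n ≤ Real.log (2 * N / δ) / n := by gcongr
  have : 0 ≤ Real.log (N / δ) / n := by positivity
  linarith

end OfflineRL

open OfflineRL in
theorem proposition1_general {S A : Type*} [MeasurableSpace S] [MeasurableSpace A]
    {ν : Kernel (S × A) (S × ℝ)} [IsSFiniteKernel ν]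
    {M : Set (Model ν)} {T : Model ν} (hT : T ∈ M)
    {ρ : Measure (S × A)} [IsProbabilityMeasure ρ] {n : ℕ} (hn : 0 < n) {δ : ℝ} (hδ : 0 < δ)
    {ε : ℝ} (hε : 0 ≤ ε) {N : ℕ} (hN : HasBracketing ρ M ε N)
    {ξ : ℝ} (hξ : 4 * (Real.log (N / δ) / n + ε) ≤ ξ) :
    ∃ E : Set (Fin n → (S × A) × (S × ℝ)), MeasurableSet E ∧
      ENNReal.ofReal (1 - δ) ≤ datasetLaw ρ T n E ∧
      ∀ D ∈ E, ∀ P ∈ M, ∏ i, T.density (D i).1 (D i).2 ≤ ∏ i, P.density (D i).1 (D i).2 →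
        T ∈ plausibleModels M ξ D P := by
  have hNpos := hN.pos ⟨T, hT⟩
  obtain ⟨u, hu, hmass, hcover⟩ := hN.exists_envelopes
  have hpos : ∀ᵐ D ∂(datasetLaw ρ T n), ∀ i, 0 < T.density (D i).1 (D i).2 :=
    ae_datasetLaw_forall (ae_compProd_withDensity_pos ρ T.measurable_density)
  have hfin : ∀ᵐ D ∂(datasetLaw ρ T n), ∀ j i, ∫⁻ y, u j (D i).1 y ∂(ν (D i).1) < ∞ :=
    ae_all_iff.2 fun j => ae_datasetLaw_forall <| Measure.ae_compProd_of_ae_fst _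
      (measurableSet_lt (measurable_lintegral_kernel (hu j)) measurable_const)
      (ae_lt_top (measurable_lintegral_kernel (hu j)) (ne_top_of_le_ne_top (by simp) (hmass j)))
  refine exists_measurableSet_forall_of_ae_notMem hδ.le
    (datasetLaw_sum_prod_envelopeScore_ge_le T hε hδ hNpos hu hmass) ?_
  filter_upwards [hpos, hfin] with D hDpos hDfin hD P hP hlik
  obtain ⟨j, hPu⟩ := hcover P hP
  refine ⟨hT, le_of_not_gt fun hfar => hD ?_⟩
  calc ENNReal.ofReal (N / δ * Real.exp (n * ε))
      ≤ ENNReal.ofReal (Real.exp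
          ((∑ i, tvDist (P.kernel (D i).1) (T.kernel (D i).1) ^ 2) / 4)) :=
        ENNReal.ofReal_le_ofReal <| mul_exp_le_exp_of_le_div (by positivity) (mod_cast hn)
          (hξ.trans hfar.le)
    _ ≤ ∏ i, envelopeScore ν T.density (u j) (D i) :=
        exp_sum_sq_tvDist_le_prod_envelopeScore (hu j) hPu hDpos (hDfin j) hlik
    _ ≤ ∑ j, ∏ i, envelopeScore ν T.density (u j) (D i) :=
        Finset.single_le_sum_of_canonicallyOrdered
          (f := fun j => ∏ i, envelopeScore ν T.density (u j) (D i)) (Finset.mem_univ j)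

theorem proposition1 {S A : Type*} [MeasurableSpace S] [MeasurableSpace A]
    (ν : Kernel (S × A) (S × ℝ)) [IsSFiniteKernel ν]
    (μ₀ : Measure S) [IsProbabilityMeasure μ₀] (γ : ℝ) (hγ : γ ∈ Set.Ioo (0 : ℝ) 1)
    (M : Set (OfflineRL.Model ν)) (T : OfflineRL.Model ν) (hT : T ∈ M)
    (ρ : Measure (S × A)) [IsProbabilityMeasure ρ]
    (n : ℕ) (hn : 0 < n) (δ : ℝ) (hδ : δ ∈ Set.Ioo (0 : ℝ) 1)
    (ε : ℝ) (hε : 0 ≤ ε) (N : ℕ) (hN : OfflineRL.HasBracketing ρ M ε N)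
    (ξ : ℝ) (hξ : 16 * (Real.log (2 * N / δ) / n + ε) ≤ ξ)
    (π : Kernel S A) [IsMarkovKernel π]
    (hV : ∀ P ∈ M, OfflineRL.HasValue μ₀ γ π P) :
    ∃ E : Set (Fin n → (S × A) × (S × ℝ)), MeasurableSet E ∧
      ENNReal.ofReal (1 - δ) ≤ OfflineRL.datasetLaw ρ T n E ∧
      ∀ D ∈ E, ∀ Pmle : OfflineRL.Model ν, OfflineRL.IsMLE M D Pmle →
        (⨅ P ∈ OfflineRL.plausibleModels M ξ D Pmle, (OfflineRL.value μ₀ γ π P : EReal)) ≤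
          (OfflineRL.value μ₀ γ π T : EReal) := by
  obtain ⟨E, hE, hE_prob, hmem⟩ := proposition1_general hT hn hδ.1 hε hN
    ((OfflineRL.four_mul_log_div_add_le hδ hε (hN.pos ⟨T, hT⟩) n).trans hξ)
  exact ⟨E, hE, hE_prob, fun D hD P hP => iInf₂_le T (hmem D hD P hP.1 (hP.2 T hT))⟩
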